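/- Let $d\ge 1$ and let $\|\cdot\|$ be a norm on $\mathbb{R}^d$, with unit ball $B=\{x:\|x\|\le 1\}$ and unit sphere $S=\{x:\|x\|=1\}$; let $\langle\cdot,\cdot\rangle$ be the Euclidean scalar product and $\|y\|_\star=\sup_{\|x\|\le1}\langle x,y\rangle$ the dual norm. A norm $N$ is *orthant-strictly monotonic* if $N(x)<N(x')$ whenever $|x_i|\le|x'_i|$ and $x_ix'_i\ge0$ for all $i$, and $|x_j|<|x'_j|$ for some $j$. For $K\subset\{1,\dots,d\}$ let $y_K$ coincide with $y$ on $K$ and vanish outside $K$. For $k\in\{1,\dots,d\}$ let $\|y\|^{\rm top}_{k}=\sup_{|K|\le k}\|y_K\|_\star$ (generalized top-$k$ dual norm), let $\|\cdot\|^{\rm sup}_{k}$ be its dual norm (generalized $k$-support dual norm), and let $B_k$ and $S_k$ be the unit ball and unit sphere of $\|\cdot\|^{\rm sup}_{k}$; by convention $\|\cdot\|^{\rm top}_0=0$ and $B_0=S_0=\{0\}$. Let $\ell_0(x)$ be the number of nonzero components of $x$. Let $c(x,y)=\langle x,y\rangle/\|x\|$ for $x\ne0$ and $c(0,y)=0$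 (the Capra coupling), and let $n(x)=x/\|x\|$ for $x\neq 0$, $n(0)=0$. With the convention $(+\infty)+(-\infty)=-\infty$, for $f:\mathbb{R}^d\to[-\infty,+\infty]$ let $f^{c}(y)=\sup_x\big(c(x,y)-f(x)\big)$ and $\partial_c f(x)=\{y: f^c(y)=c(x,y)-f(x)\}$ (Capra-conjugate and Capra-subdifferential), and let $f^{\star}$ and $\partial f(x)$ be the Fenchel conjugate and the Rockafellar–Moreau subdifferential, obtained in the same way with $\langle x,y\rangle$ in place of $c(x,y)$; for a function $g$ of the dual variable let $g^{\star'}(x)=\sup_y\big(\langle x,y\rangle-g(y)\big)$. A function $f:\mathbb{R}^d\to[-\infty,+\infty]$ is convex if its epigraph in $\mathbb{R}^d\times\mathbb{R}$ is convex, and proper if it never takes the value $-\infty$ and is not identically $+\infty$. Let $\delta_A$ be $0$ on $A$ and $+\infty$ outside $A$, and let $\Delta_{d+1}=\{(\lambda_0,\dots,\lambda_d):\lambda_l\ge 0,\ \sum_{l=0}^d\lambda_l=1\}$. **Proposition.** Suppose that both $\|\cdot\|$ and $\|\cdot\|_\star$ are orthant-strictly monotonic. Let $\varphi:\{0,\dots,d\}\to[0,+\infty)$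 be nondecreasing with $\varphi(0)=0$, and let $L=\big((\varphi\circ\ell_0)^{c}\big)^{\star'}$. Then: (a) $L$ is proper, convex and lower semicontinuous (lsc). (b) $(\varphi\circ\ell_0)(s)=L(s)$ for all $s\in S$. (c) $\partial_c(\varphi\circ\ell_0)(s)=\partial L(s)$ for all $s\in S$. (d) $\varphi\circ\ell_0=L\circ n$; equivalently, $\varphi(\ell_0(x))=L(x/\|x\|)$ for all $x\ne0$. (e) $L=\big(\sup_{0\le l\le d}\,[\,\|\cdot\|^{\rm top}_{l}-\varphi(l)]\big)^{\star'}$. (f) $L$ is the largest convex lsc function below $x\mapsto\inf_{0\le l\le d}[\delta_{B_l}(x)+\varphi(l)]$; this function equals $\varphi(l)$ on $B_l\setminus B_{l-1}$ for $1\le l\le d$, equals $0$ at $0$, and is $+\infty$ outside $B_d$, where $B_0\subset B_1\subset\dots\subset B_d=B$. (g) $L$ is the largest convex lsc function below $x\mapsto\inf_{0\le l\le d}[\delta_{S_l}(x)+\varphi(l)]=\inf\{\varphi(l): 0\le l\le d,\ x\in S_l\}$ (with $\inf\emptyset=+\infty$). (h) For all $x\in\mathbb{R}^d$, $$L(x)=\min_{\substack{\lambda\in\Delta_{d+1}\\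 x\in\sum_{l=1}^d\lambda_lB_l}}\sum_{l=1}^d\lambda_l\varphi(l)=\min_{\substack{\lambda\in\Delta_{d+1}\\ x\in\sum_{l=1}^d\lambda_lS_l}}\sum_{l=1}^d\lambda_l\varphi(l)=\min_{\substack{x^{(1)},\dots,x^{(d)}\in\mathbb{R}^d\\ \sum_{l=1}^d\|x^{(l)}\|^{\rm sup}_{l}\le1\\ \sum_{l=1}^dx^{(l)}=x}}\sum_{l=1}^d\varphi(l)\,\|x^{(l)}\|^{\rm sup}_{l},$$ where each minimum is attained whenever its feasible set is nonempty, and equals $+\infty$ otherwise. -/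

import Mathlib

open scoped Pointwise

namespace Capra

noncomputable section

/-! ### Generalized conjugacies for functions with values in `[-∞, +∞]`

Addition on `EReal` satisfies `⊤ + ⊥ = ⊥ + ⊤ = ⊥`, so it is Moreau's lower addition. -/

/-- The Fenchel-Moreau conjugate `y ↦ sup_x (c(x, y) ∔ (-f(x)))` of `f` for a finite coupling. -/
def conjugate {X Y : Type*} (c : X → Y → ℝ) (f : X → EReal) (y : Y) : EReal :=
  ⨆ x : X, ((c x y : EReal) + -(f x))

/-- The subdifferential of `f` at `x` with respect to the coupling `c`. -/
def subdifferential {X Y : Type*} (c : X → Y → ℝ) (f : X → EReal) (x : X) : Set Y :=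
  {y | conjugate c f y = (c x y : EReal) + -(f x)}

/-- The scalar product of `ℝ^d`, as a coupling. -/
def scalarProduct {d : ℕ} (x y : Fin d → ℝ) : ℝ := x ⬝ᵥ y

/-- The reverse Fenchel conjugate `x ↦ sup_y (⟨x, y⟩ ∔ (-g(y)))`. -/
def reverseFenchel {d : ℕ} (g : (Fin d → ℝ) → EReal) : (Fin d → ℝ) → EReal :=
  conjugate (fun y x => scalarProduct x y) g

/-- The coupling that is constant along primal rays, for the source norm `N`. -/
def coupling {d : ℕ} (N : (Fin d → ℝ) → ℝ) (x y : Fin d → ℝ) : ℝ :=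
  if x = 0 then 0 else scalarProduct x y / N x

/-- The normalization mapping. -/
def normalization {d : ℕ} (N : (Fin d → ℝ) → ℝ) (x : Fin d → ℝ) : Fin d → ℝ :=
  if x = 0 then 0 else (N x)⁻¹ • x

/-! ### Convexity notions for functions with values in `[-∞, +∞]` -/

/-- Convexity: the epigraph (a subset of `E × ℝ`) is convex. -/
def IsConvex {E : Type*} [AddCommGroup E] [Module ℝ E] (f : E → EReal) : Prop :=
  Convex ℝ {p : E × ℝ | f p.1 ≤ (p.2 : EReal)}

/-- The function never takes the value `-∞` and is not identically `+∞`. -/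
def IsProper {E : Type*} (f : E → EReal) : Prop :=
  (∀ x, f x ≠ ⊥) ∧ ∃ x, f x ≠ ⊤

/-- `f` is the largest convex lower semicontinuous function below `h`. -/
def IsLargestConvexLscBelow {d : ℕ} (f h : (Fin d → ℝ) → EReal) : Prop :=
  IsGreatest {g : (Fin d → ℝ) → EReal | IsConvex g ∧ LowerSemicontinuous g ∧ g ≤ h} f

open Classical in
/-- The function equal to `0` on `S` and to `+∞` outside of `S`. -/
def indicator {E : Type*} (S : Set E) (x : E) : EReal := if x ∈ S then 0 else ⊤

/-- `a` is the minimum of `cost` over the feasible set `S`: it is the infimum (hence `+∞` if `S` is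
empty), and it is attained as soon as `S` is nonempty. -/
def IsMinOver {α : Type*} (S : Set α) (cost : α → ℝ) (a : EReal) : Prop :=
  (a = ⨅ s ∈ S, (cost s : EReal)) ∧ (S.Nonempty → ∃ s ∈ S, a = (cost s : EReal))

/-! ### The pseudonorm `ℓ₀` and the norms attached to the source norm -/

/-- The number of nonzero components, an element of `{0, …, d}`. -/
def lzero {d : ℕ} (x : Fin d → ℝ) : Fin (d + 1) :=
  ⟨(Finset.univ.filter fun i => x i ≠ 0).card,
    Nat.lt_succ_of_le ((Finset.card_filter_le _ _).trans_eq (Finset.card_fin d))⟩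

/-- Orthant-strict monotonicity. -/
def OrthantStrictlyMonotonic {d : ℕ} (N : (Fin d → ℝ) → ℝ) : Prop :=
  ∀ x x' : Fin d → ℝ, (∀ i, |x i| ≤ |x' i|) → (∃ j, |x j| < |x' j|) → (∀ i, 0 ≤ x i * x' i) →
    N x < N x'

/-- The dual norm `y ↦ sup_{N x ≤ 1} ⟨x, y⟩`. -/
def dualNorm {d : ℕ} (N : (Fin d → ℝ) → ℝ) (y : Fin d → ℝ) : ℝ :=
  sSup ((fun x => scalarProduct x y) '' {x | N x ≤ 1})

/-- The vector `y_K`, which coincides with `y` on `K` and vanishes outside of `K`. -/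
def restrict {d : ℕ} (K : Finset (Fin d)) (y : Fin d → ℝ) : Fin d → ℝ :=
  fun i => if i ∈ K then y i else 0

/-- The generalized top-`k` dual norm `y ↦ sup_{|K| ≤ k} ‖y_K‖_⋆` (a maximum over finitely many
sets `K`; it is the null function for `k = 0`). -/
def topDualNorm {d : ℕ} (N : (Fin d → ℝ) → ℝ) (k : ℕ) (y : Fin d → ℝ) : ℝ :=
  ⨆ K : {K : Finset (Fin d) // K.card ≤ k}, dualNorm N (restrict K.1 y)

/-- The generalized `k`-support dual norm, dual to the generalized top-`k` dual norm; null for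
`k = 0` by convention. -/
def supportDualNorm {d : ℕ} (N : (Fin d → ℝ) → ℝ) (k : ℕ) : (Fin d → ℝ) → ℝ :=
  if k = 0 then 0 else dualNorm (topDualNorm N k)

/-- The unit ball of the generalized `k`-support dual norm; `{0}` for `k = 0` by convention. -/
def supportBall {d : ℕ} (N : (Fin d → ℝ) → ℝ) (k : ℕ) : Set (Fin d → ℝ) :=
  if k = 0 then {0} else {x | supportDualNorm N k x ≤ 1}

/-- The unit sphere of the generalized `k`-support dual norm; `{0}` for `k = 0` by convention. -/
def supportSphere {d : ℕ} (N : (Fin d → ℝ) → ℝ) (k : ℕ) : Set (Fin d → ℝ) :=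
  if k = 0 then {0} else {x | supportDualNorm N k x = 1}

/-! ### The functions in the result -/

/-- The function `φ ∘ ℓ₀`. -/
def phiLzero {d : ℕ} (φ : Fin (d + 1) → ℝ) (x : Fin d → ℝ) : EReal := (φ (lzero x) : EReal)

/-- The function `L`: the reverse Fenchel conjugate of the Capra-conjugate of `φ ∘ ℓ₀`. -/
def calL {d : ℕ} (N : (Fin d → ℝ) → ℝ) (φ : Fin (d + 1) → ℝ) : (Fin d → ℝ) → EReal :=
  reverseFenchel (conjugate (coupling N) (phiLzero φ))

/-- `x ↦ inf_{0 ≤ l ≤ d} (δ_{B_l}(x) + φ(l))`, for a family of sets `B_0, …, B_d`. -/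
def stepFunction {d : ℕ} (B : ℕ → Set (Fin d → ℝ)) (φ : Fin (d + 1) → ℝ) (x : Fin d → ℝ) :
    EReal :=
  ⨅ l : Fin (d + 1), (indicator (B l) x + (φ l : EReal))

/-- The `(λ_0, …, λ_d)` in the simplex with `x ∈ ∑_{l=1}^d λ_l B_l` (Minkowski sum). -/
def simplexFeasible {d : ℕ} (B : ℕ → Set (Fin d → ℝ)) (x : Fin d → ℝ) : Set (Fin (d + 1) → ℝ) :=
  {w | w ∈ stdSimplex ℝ (Fin (d + 1)) ∧ x ∈ ∑ l : Fin d, w l.succ • B (l + 1)}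

/-- The `(x^(1), …, x^(d))` with sum `x` and `∑_{l=1}^d ‖x^(l)‖ ≤ 1`, the norm of `x^(l)` being the
generalized `l`-support dual norm. The entry of index `l : Fin d` is `x^(l+1)`. -/
def decompositions {d : ℕ} (N : (Fin d → ℝ) → ℝ) (x : Fin d → ℝ) : Set (Fin d → Fin d → ℝ) :=
  {z | ∑ l : Fin d, supportDualNorm N (l + 1) (z l) ≤ 1 ∧ ∑ l : Fin d, z l = x}

end

end Capra

open Capra

/-! Everything rests on one finite function, the envelope `E(y) = max_l (‖y‖_l^top - φ(l))`.
Truncating a vector to some coordinates does not increase the source norm, so each top-`l` norm is a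
maximum of `⟨x, y⟩` over vectors of the unit ball with at most `l` nonzero entries. Hence `E` is the
Capra-conjugate of `φ ∘ ℓ₀` (`conjugate_coupling`), and `L`, its Fenchel conjugate, is a supremum of
affine functions.

The second ingredient is a duality: `L(x)` is the least cost `∑ φ(l) ‖x^(l)‖` over decompositions of
`x` of total norm at most one. Weak duality (`calL_le_decompositionCost`) sums the dual norm
inequalities. Strong duality (`exists_lt_of_notMem_decompositionEpigraph`) separates a point from
the epigraph of the least cost, which is convex and, by compactness, closed. Normalizing each piece
turns decompositions into weights on balls or spheres; applying convexity at optimal weights then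
gives maximality of `L` among convex lsc minorants.

Strict monotonicity enters on the unit sphere (`le_decompositionCost_of_sphere`): `s` has a norming
vector `y` with exactly the support of `s`, and its top-`k` norms are below one for `k < ℓ₀(s)`.
Testing a decomposition of `s` against `y` leaves no mass on those levels, so its cost is at least
`φ(ℓ₀(s))`. Hence `φ ∘ ℓ₀ = L` there; homogeneity of degree zero gives `φ ∘ ℓ₀ = L ∘ n`, and then
`L` and `φ ∘ ℓ₀` have the same conjugate, hence the same subdifferentials on the sphere. -/

namespace Capra

section

/-! ### Norms on `ℝ^d` as real functions, and their dual norms -/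

/-- The real function `f` on `ℝ^d` is a norm. -/
structure IsNorm {d : ℕ} (f : (Fin d → ℝ) → ℝ) : Prop where
  add_le : ∀ x y, f (x + y) ≤ f x + f y
  smul_eq : ∀ (a : ℝ) x, f (a • x) = |a| * f x
  eq_zero : ∀ x, f x = 0 → x = 0

variable {d : ℕ} {f : (Fin d → ℝ) → ℝ}

theorem scalarProduct_comm (x y : Fin d → ℝ) : scalarProduct x y = scalarProduct y x :=
  dotProduct_comm x y

theorem scalarProduct_add (x y z : Fin d → ℝ) :
    scalarProduct x (y + z) = scalarProduct x y + scalarProduct x z := dotProduct_add x y z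

theorem add_scalarProduct (x y z : Fin d → ℝ) :
    scalarProduct (x + y) z = scalarProduct x z + scalarProduct y z := add_dotProduct x y z

theorem scalarProduct_smul (a : ℝ) (x y : Fin d → ℝ) :
    scalarProduct x (a • y) = a * scalarProduct x y := by
  simp [scalarProduct, dotProduct_smul]

theorem smul_scalarProduct (a : ℝ) (x y : Fin d → ℝ) :
    scalarProduct (a • x) y = a * scalarProduct x y := by
  simp [scalarProduct, smul_dotProduct]

@[simp] theorem zero_scalarProduct (y : Fin d → ℝ) : scalarProduct 0 y = 0 :=
  zero_dotProduct y

@[simp] theorem scalarProduct_zero (y : Fin d → ℝ) : scalarProduct y 0 = 0 :=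
  dotProduct_zero y

theorem sum_scalarProduct {ι : Type*} (s : Finset ι) (z : ι → Fin d → ℝ) (y : Fin d → ℝ) :
    scalarProduct (∑ i ∈ s, z i) y = ∑ i ∈ s, scalarProduct (z i) y := sum_dotProduct s z y

theorem continuous_scalarProduct_left (y : Fin d → ℝ) : Continuous fun x => scalarProduct x y := by
  unfold scalarProduct dotProduct
  fun_prop

theorem scalarProduct_linearMap (g : (Fin d → ℝ) →ₗ[ℝ] ℝ) (z : Fin d → ℝ) :
    scalarProduct z (fun i => g (Pi.single i 1)) = g z := by
  conv_rhs => rw [← Finset.univ_sum_single z, map_sum]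
  unfold scalarProduct dotProduct
  refine Finset.sum_congr rfl fun i _ => ?_
  rw [← smul_eq_mul, ← map_smul, ← Pi.single_smul, smul_eq_mul, mul_one]

theorem scalarProduct_self_pos {x : Fin d → ℝ} (hx : x ≠ 0) : 0 < scalarProduct x x := by
  have := Matrix.dotProduct_star_self_pos_iff (v := x)
  simpa [scalarProduct] using this.2 hx

theorem isNorm_seminorm (p : Seminorm ℝ (Fin d → ℝ)) (hp : ∀ x, p x = 0 → x = 0) : IsNorm p :=
  ⟨map_add_le_add p, fun a x => by simp [map_smul_eq_mul], hp⟩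

namespace IsNorm

theorem map_zero (hf : IsNorm f) : f 0 = 0 := by simpa using hf.smul_eq 0 0

theorem nonneg (hf : IsNorm f) (x : Fin d → ℝ) : 0 ≤ f x := by
  have h := hf.add_le x ((-1 : ℝ) • x)
  rw [hf.smul_eq] at h
  simp [hf.map_zero] at h
  linarith

theorem pos (hf : IsNorm f) {x : Fin d → ℝ} (hx : x ≠ 0) : 0 < f x :=
  (hf.nonneg x).lt_of_ne fun h => hx (hf.eq_zero x h.symm)

theorem smul_of_nonneg (hf : IsNorm f) {a : ℝ} (ha : 0 ≤ a) (x : Fin d → ℝ) :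
    f (a • x) = a * f x := by rw [hf.smul_eq, abs_of_nonneg ha]

theorem convexOn (hf : IsNorm f) : ConvexOn ℝ Set.univ f :=
  ⟨convex_univ, fun x _ y _ a b ha hb _ => by
    rw [smul_eq_mul, smul_eq_mul, ← hf.smul_of_nonneg ha, ← hf.smul_of_nonneg hb]
    exact hf.add_le _ _⟩

theorem continuous (hf : IsNorm f) : Continuous f :=
  continuousOn_univ.1 (hf.convexOn.continuousOn isOpen_univ)

/-- The continuous positive function `f` is bounded away from zero on the compact unit sphere of the
ambient norm. This makes the balls of `f` bounded. -/
theorem exists_mul_norm_le (hf : IsNorm f) : ∃ c > 0, ∀ x, c * ‖x‖ ≤ f x := by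
  obtain ⟨c, hc, h⟩ := (isCompact_sphere (0 : Fin d → ℝ) 1).exists_forall_le'
    hf.continuous.continuousOn (a := 0) fun x hx => hf.pos fun h => by simp [h] at hx
  refine ⟨c, hc, fun x => ?_⟩
  rcases eq_or_ne x 0 with rfl | hx
  · simp [hf.map_zero]
  have hx' : 0 < ‖x‖ := norm_pos_iff.2 hx
  have := h (‖x‖⁻¹ • x) (by simp [norm_smul, hx'.ne'])
  rw [hf.smul_of_nonneg (by positivity)] at this
  calc c * ‖x‖ ≤ (‖x‖⁻¹ * f x) * ‖x‖ := by gcongr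
    _ = f x := by field_simp

theorem isCompact_ball (hf : IsNorm f) (r : ℝ) : IsCompact {x | f x ≤ r} := by
  obtain ⟨c, hc, h⟩ := hf.exists_mul_norm_le
  refine (isCompact_closedBall (0 : Fin d → ℝ) (r / c)).of_isClosed_subset
    (isClosed_le hf.continuous continuous_const) fun x hx => ?_
  rw [mem_closedBall_zero_iff, le_div_iff₀ hc, mul_comm]
  exact (h x).trans hx

theorem bddAbove (hf : IsNorm f) (y : Fin d → ℝ) :
    BddAbove ((fun x => scalarProduct x y) '' {x | f x ≤ 1}) :=
  ((hf.isCompact_ball 1).image (continuous_scalarProduct_left y)).bddAbove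

theorem scalarProduct_le_dualNorm (hf : IsNorm f) {x : Fin d → ℝ} (hx : f x ≤ 1)
    (y : Fin d → ℝ) : scalarProduct x y ≤ dualNorm f y :=
  le_csSup (hf.bddAbove y) ⟨x, hx, rfl⟩

theorem dualNorm_le (hf : IsNorm f) {y : Fin d → ℝ} {r : ℝ}
    (h : ∀ x, f x ≤ 1 → scalarProduct x y ≤ r) : dualNorm f y ≤ r := by
  refine csSup_le ⟨_, 0, ?_, rfl⟩ (by rintro _ ⟨x, hx, rfl⟩; exact h x hx)
  simp [hf.map_zero]

theorem exists_dualNorm_eq (hf : IsNorm f) (y : Fin d → ℝ) :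
    ∃ x, f x ≤ 1 ∧ scalarProduct x y = dualNorm f y := by
  obtain ⟨x, hx, h⟩ := (hf.isCompact_ball 1).exists_isMaxOn ⟨0, by simp [hf.map_zero]⟩
    (continuous_scalarProduct_left y).continuousOn
  exact ⟨x, hx, (hf.scalarProduct_le_dualNorm hx y).antisymm (hf.dualNorm_le fun x' hx' => h hx')⟩

theorem scalarProduct_le (hf : IsNorm f) (x y : Fin d → ℝ) :
    scalarProduct x y ≤ f x * dualNorm f y := by
  rcases eq_or_ne x 0 with rfl | hx
  · simp [hf.map_zero]
  have hx' := hf.pos hx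
  have := hf.scalarProduct_le_dualNorm (x := (f x)⁻¹ • x)
    (by rw [hf.smul_of_nonneg (by positivity), inv_mul_cancel₀ hx'.ne']) y
  rw [smul_scalarProduct] at this
  calc scalarProduct x y = f x * ((f x)⁻¹ * scalarProduct x y) := by field_simp
    _ ≤ _ := by gcongr

theorem dual (hf : IsNorm f) : IsNorm (dualNorm f) where
  add_le y z := hf.dualNorm_le fun x hx => by
    rw [scalarProduct_add]
    exact add_le_add (hf.scalarProduct_le_dualNorm hx y) (hf.scalarProduct_le_dualNorm hx z)
  smul_eq := by
    have key : ∀ (a : ℝ) y, dualNorm f (a • y) ≤ |a| * dualNorm f y := fun a y =>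
      hf.dualNorm_le fun x hx => by
        have h := hf.scalarProduct_le (a • x) y
        rw [hf.smul_eq, smul_scalarProduct, ← scalarProduct_smul] at h
        refine h.trans ?_
        have h0 : 0 ≤ dualNorm f y := by
          simpa using hf.scalarProduct_le_dualNorm (x := 0) (by simp [hf.map_zero]) y
        calc |a| * f x * dualNorm f y ≤ |a| * 1 * dualNorm f y := by gcongr
          _ = _ := by ring
    intro a y
    refine (key a y).antisymm ?_
    rcases eq_or_ne a 0 with rfl | ha
    · simpa using hf.scalarProduct_le_dualNorm (x := 0) (by simp [hf.map_zero]) _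
    have := key a⁻¹ (a • y)
    rw [smul_smul, inv_mul_cancel₀ ha, one_smul, abs_inv] at this
    have ha' : 0 < |a| := abs_pos.2 ha
    calc |a| * dualNorm f y ≤ |a| * (|a|⁻¹ * dualNorm f (a • y)) := by gcongr
      _ = _ := by field_simp
  eq_zero y hy := by
    by_contra h
    have := hf.scalarProduct_le y y
    rw [hy, mul_zero] at this
    exact absurd (scalarProduct_self_pos h) this.not_gt

/-- A vector of dual norm at most one that attains the norm of `x`. -/
theorem exists_norming (hf : IsNorm f) {x : Fin d → ℝ} (hx : x ≠ 0) :
    ∃ y, dualNorm f y ≤ 1 ∧ scalarProduct x y = f x := by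
  -- Hahn-Banach: the functional `a • x ↦ a * f x` on the line through `x` extends with `g ≤ f`; the
  -- vector sought lists the values of `g` on the canonical basis.
  obtain ⟨g, hg, hgf⟩ := exists_extension_of_le_sublinear
    (LinearPMap.mkSpanSingleton x (f x) hx) f (fun c hc x => hf.smul_of_nonneg hc.le x)
    hf.add_le (by
      rintro ⟨z, hz⟩
      obtain ⟨a, rfl⟩ := Submodule.mem_span_singleton.1 hz
      rw [LinearPMap.mkSpanSingleton'_apply, hf.smul_eq, smul_eq_mul]
      exact mul_le_mul_of_nonneg_right (le_abs_self a) (hf.nonneg x))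
  refine ⟨fun i => g (Pi.single i 1), hf.dualNorm_le fun z hz => ?_, ?_⟩
  · rw [scalarProduct_linearMap]
    exact (hgf z).trans hz
  · rw [scalarProduct_linearMap]
    exact (hg ⟨x, Submodule.mem_span_singleton_self x⟩).trans
      (LinearPMap.mkSpanSingleton'_apply_self _ _ _ _)

theorem dualNorm_dualNorm (hf : IsNorm f) : dualNorm (dualNorm f) = f := by
  funext x
  refine le_antisymm (hf.dual.dualNorm_le fun y hy => ?_) ?_
  · rw [scalarProduct_comm]
    refine (hf.scalarProduct_le x y).trans ?_
    simpa using mul_le_mul_of_nonneg_left hy (hf.nonneg x)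
  · rcases eq_or_ne x 0 with rfl | hx
    · rw [hf.map_zero, hf.dual.dual.map_zero]
    obtain ⟨y, hy, hxy⟩ := hf.exists_norming hx
    rw [← hxy, scalarProduct_comm]
    exact hf.dual.scalarProduct_le_dualNorm hy x

end IsNorm

end

/-! ### Restrictions and generalized top-`k` dual norms -/

section

variable {d : ℕ} {N : (Fin d → ℝ) → ℝ} {φ : Fin (d + 1) → ℝ}

theorem restrict_add (K : Finset (Fin d)) (x y : Fin d → ℝ) :
    restrict K (x + y) = restrict K x + restrict K y := by
  funext i
  by_cases h : i ∈ K <;> simp [restrict, h]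

theorem restrict_smul (K : Finset (Fin d)) (a : ℝ) (x : Fin d → ℝ) :
    restrict K (a • x) = a • restrict K x := by
  funext i
  by_cases h : i ∈ K <;> simp [restrict, h]

theorem restrict_univ (x : Fin d → ℝ) : restrict Finset.univ x = x := by
  funext i
  simp [restrict]

theorem restrict_empty (x : Fin d → ℝ) : restrict ∅ x = 0 := by
  funext i
  simp [restrict]

theorem restrict_support (x : Fin d → ℝ) :
    restrict (Finset.univ.filter fun i => x i ≠ 0) x = x := by
  funext i
  by_cases h : x i = 0 <;> simp [restrict, h]

theorem restrict_scalarProduct (K : Finset (Fin d)) (x y : Fin d → ℝ) :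
    scalarProduct (restrict K x) y = scalarProduct x (restrict K y) := by
  unfold scalarProduct dotProduct
  refine Finset.sum_congr rfl fun i _ => ?_
  by_cases h : i ∈ K <;> simp [restrict, h]

theorem lzero_restrict_le (K : Finset (Fin d)) (x : Fin d → ℝ) :
    (lzero (restrict K x) : ℕ) ≤ K.card := by
  change (Finset.univ.filter fun i => restrict K x i ≠ 0).card ≤ K.card
  refine Finset.card_le_card fun i hi => ?_
  by_contra h
  simp [restrict, h] at hi

theorem lzero_zero : lzero (0 : Fin d → ℝ) = 0 := by
  simp [lzero]

namespace OrthantStrictlyMonotonic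

theorem restrict_lt (h : OrthantStrictlyMonotonic N) {K : Finset (Fin d)} {x : Fin d → ℝ}
    {i : Fin d} (hi : i ∉ K) (hx : x i ≠ 0) : N (restrict K x) < N x := by
  refine h _ _ (fun j => ?_) ⟨i, by simpa [restrict, hi] using hx⟩ fun j => ?_
  · by_cases hj : j ∈ K <;> simp [restrict, hj]
  · by_cases hj : j ∈ K <;> simp [restrict, hj, mul_self_nonneg]

theorem restrict_le (h : OrthantStrictlyMonotonic N) (K : Finset (Fin d)) (x : Fin d → ℝ) :
    N (restrict K x) ≤ N x := by
  by_cases hx : ∃ i, i ∉ K ∧ x i ≠ 0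
  · obtain ⟨i, hi, hx⟩ := hx
    exact (h.restrict_lt hi hx).le
  · push Not at hx
    refine le_of_eq (congrArg N (funext fun i => ?_))
    by_cases hi : i ∈ K
    · simp [restrict, hi]
    · simp [restrict, hi, hx i hi]

end OrthantStrictlyMonotonic

theorem dualNorm_restrict_le_topDualNorm {K : Finset (Fin d)} {k : ℕ} (hK : K.card ≤ k)
    (y : Fin d → ℝ) : dualNorm N (restrict K y) ≤ topDualNorm N k y :=
  le_ciSup (f := fun K : {K : Finset (Fin d) // K.card ≤ k} => dualNorm N (restrict K.1 y))
    (Set.finite_range _).bddAbove ⟨K, hK⟩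

theorem exists_topDualNorm_eq (N : (Fin d → ℝ) → ℝ) (k : ℕ) (y : Fin d → ℝ) :
    ∃ K : Finset (Fin d), K.card ≤ k ∧ dualNorm N (restrict K y) = topDualNorm N k y := by
  have : Nonempty {K : Finset (Fin d) // K.card ≤ k} := ⟨⟨∅, by simp⟩⟩
  obtain ⟨K, hK⟩ := exists_eq_ciSup_of_finite
    (f := fun K : {K : Finset (Fin d) // K.card ≤ k} => dualNorm N (restrict K.1 y))
  exact ⟨K.1, K.2, hK⟩

theorem topDualNorm_mono {k l : ℕ} (hkl : k ≤ l) (y : Fin d → ℝ) :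
    topDualNorm N k y ≤ topDualNorm N l y := by
  obtain ⟨K, hK, h⟩ := exists_topDualNorm_eq N k y
  exact h ▸ dualNorm_restrict_le_topDualNorm (hK.trans hkl) y

theorem topDualNorm_zero (hN : IsNorm N) (y : Fin d → ℝ) : topDualNorm N 0 y = 0 := by
  obtain ⟨K, hK, h⟩ := exists_topDualNorm_eq N 0 y
  rw [← h, Finset.card_eq_zero.1 (Nat.le_zero.1 hK), restrict_empty, hN.dual.map_zero]

theorem topDualNorm_self (h : OrthantStrictlyMonotonic (dualNorm N)) :
    topDualNorm N d = dualNorm N := by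
  funext y
  refine le_antisymm ?_ ?_
  · obtain ⟨K, -, hK⟩ := exists_topDualNorm_eq N d y
    exact hK ▸ h.restrict_le K y
  · conv_lhs => rw [← restrict_univ y]
    exact dualNorm_restrict_le_topDualNorm (by simp) y

theorem topDualNorm_smul_of_nonneg (hN : IsNorm N) (k : ℕ) {a : ℝ} (ha : 0 ≤ a)
    (y : Fin d → ℝ) : topDualNorm N k (a • y) = a * topDualNorm N k y := by
  simp only [topDualNorm, restrict_smul, hN.dual.smul_of_nonneg ha]
  exact (Real.mul_iSup_of_nonneg ha _).symm

/-- The shift to `k + 1` lets singletons compete in the supremum, and these detect every coordinate;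
at index `0` the function is null. -/
theorem isNorm_topDualNorm (hN : IsNorm N) (k : ℕ) : IsNorm (topDualNorm N (k + 1)) where
  add_le x y := by
    obtain ⟨K, hK, h⟩ := exists_topDualNorm_eq N (k + 1) (x + y)
    rw [← h, restrict_add]
    exact (hN.dual.add_le _ _).trans (add_le_add (dualNorm_restrict_le_topDualNorm hK x)
      (dualNorm_restrict_le_topDualNorm hK y))
  smul_eq a x := by
    simp only [topDualNorm, restrict_smul, hN.dual.smul_eq]
    exact (Real.mul_iSup_of_nonneg (abs_nonneg a) _).symm
  eq_zero x hx := by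
    funext i
    have h := dualNorm_restrict_le_topDualNorm (N := N) (K := {i}) (k := k + 1) (by simp) x
    rw [hx] at h
    simpa [restrict] using congrFun (hN.dual.eq_zero _ (h.antisymm (hN.dual.nonneg _))) i

/-! ### Generalized support dual norms, their balls and spheres -/

theorem supportDualNorm_succ (N : (Fin d → ℝ) → ℝ) (k : ℕ) :
    supportDualNorm N (k + 1) = dualNorm (topDualNorm N (k + 1)) := by
  simp [supportDualNorm]

theorem isNorm_supportDualNorm (hN : IsNorm N) (k : ℕ) : IsNorm (supportDualNorm N (k + 1)) := by
  rw [supportDualNorm_succ]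
  exact (isNorm_topDualNorm hN k).dual

theorem mem_supportBall_succ {k : ℕ} {x : Fin d → ℝ} :
    x ∈ supportBall N (k + 1) ↔ supportDualNorm N (k + 1) x ≤ 1 := by
  simp [supportBall]

theorem mem_supportSphere_succ {k : ℕ} {x : Fin d → ℝ} :
    x ∈ supportSphere N (k + 1) ↔ supportDualNorm N (k + 1) x = 1 := by
  simp [supportSphere]

theorem supportSphere_subset_supportBall (N : (Fin d → ℝ) → ℝ) (k : ℕ) :
    supportSphere N k ⊆ supportBall N k := by
  cases k with
  | zero => simp [supportSphere, supportBall]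
  | succ k => exact fun x hx => mem_supportBall_succ.2 (mem_supportSphere_succ.1 hx).le

/-- Top norms increase with `k`, so their dual norms decrease; only `k = 0`, fixed by convention,
needs a separate argument. -/
theorem supportBall_subset_succ (hN : IsNorm N) (k : ℕ) :
    supportBall N k ⊆ supportBall N (k + 1) := by
  cases k with
  | zero =>
    intro x hx
    obtain rfl : x = 0 := by simpa [supportBall] using hx
    rw [mem_supportBall_succ, (isNorm_supportDualNorm hN 0).map_zero]
    exact zero_le_one
  | succ k =>
    intro x hx
    rw [mem_supportBall_succ, supportDualNorm_succ] at hx ⊢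
    refine (isNorm_topDualNorm hN (k + 1)).dualNorm_le fun y hy => ?_
    exact ((isNorm_topDualNorm hN k).scalarProduct_le_dualNorm
      ((topDualNorm_mono (Nat.le_succ _) y).trans hy) x).trans hx

theorem supportBall_mono (hN : IsNorm N) : Monotone (supportBall N) :=
  monotone_nat_of_le_succ (supportBall_subset_succ hN)

theorem supportBall_self (hd : 0 < d) (hN : IsNorm N)
    (h : OrthantStrictlyMonotonic (dualNorm N)) : supportBall N d = {x | N x ≤ 1} := by
  simp [supportBall, supportDualNorm, hd.ne', topDualNorm_self h, hN.dualNorm_dualNorm]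

theorem scalarProduct_le_topDualNorm (hN : IsNorm N) {k : ℕ} {x : Fin d → ℝ}
    (hx : x ∈ supportBall N k) (y : Fin d → ℝ) : scalarProduct x y ≤ topDualNorm N k y := by
  cases k with
  | zero =>
    obtain rfl : x = 0 := by simpa [supportBall] using hx
    simp [topDualNorm_zero hN]
  | succ k =>
    rw [mem_supportBall_succ, supportDualNorm_succ] at hx
    have hT := isNorm_topDualNorm hN k
    rw [scalarProduct_comm]
    refine (hT.scalarProduct_le y x).trans ?_
    simpa using mul_le_mul_of_nonneg_left hx (hT.nonneg y)

/-- The supremum defining the generalized top-`k` dual norm is attained at a vector with at most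
`k` nonzero components in the source unit ball. -/
theorem exists_sparse_topDualNorm_eq (hN : IsNorm N) (h : OrthantStrictlyMonotonic N) (k : ℕ)
    (y : Fin d → ℝ) :
    ∃ x, N x ≤ 1 ∧ (lzero x : ℕ) ≤ k ∧ scalarProduct x y = topDualNorm N k y := by
  obtain ⟨K, hK, hKy⟩ := exists_topDualNorm_eq N k y
  obtain ⟨x, hx, hxy⟩ := hN.exists_dualNorm_eq (restrict K y)
  exact ⟨restrict K x, (h.restrict_le K x).trans hx, (lzero_restrict_le K x).trans hK,
    by rw [restrict_scalarProduct, hxy, hKy]⟩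

/-- The truncation of `x` to its own support can be moved onto `y`, and that support competes in the
top norm of index `ℓ₀(x)`. -/
theorem scalarProduct_le_topDualNorm_lzero (hN : IsNorm N) {x : Fin d → ℝ} (hx : N x ≤ 1)
    (y : Fin d → ℝ) : scalarProduct x y ≤ topDualNorm N (lzero x) y := by
  rw [← restrict_support x, restrict_scalarProduct, restrict_support x]
  exact (hN.scalarProduct_le_dualNorm hx _).trans (dualNorm_restrict_le_topDualNorm le_rfl y)

theorem lzero_eq_zero {x : Fin d → ℝ} (hx : lzero x = 0) : x = 0 := by
  funext i
  by_contra h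
  have h0 : (Finset.univ.filter fun i => x i ≠ 0).card = 0 := congrArg Fin.val hx
  rw [Finset.card_eq_zero] at h0
  exact Finset.notMem_empty i (h0 ▸ Finset.mem_filter.2 ⟨Finset.mem_univ i, h⟩)

theorem mem_supportBall_of_lzero_le (hN : IsNorm N) {k : ℕ} {x : Fin d → ℝ} (hx : N x ≤ 1)
    (hk : (lzero x : ℕ) ≤ k) : x ∈ supportBall N k := by
  cases k with
  | zero =>
    have : x = 0 := lzero_eq_zero (Fin.ext (Nat.le_zero.1 hk))
    simp [supportBall, this]
  | succ k =>
    rw [mem_supportBall_succ, supportDualNorm_succ]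
    refine (isNorm_topDualNorm hN k).dualNorm_le fun y hy => ?_
    rw [scalarProduct_comm]
    exact (scalarProduct_le_topDualNorm_lzero hN hx y).trans ((topDualNorm_mono hk y).trans hy)

/-! ### The conjugate of `φ ∘ ℓ₀` -/

/-- `y ↦ max_{0 ≤ l ≤ d} (‖y‖_l - φ(l))`, the norm being the generalized top-`l` dual norm. -/
noncomputable def envelope (N : (Fin d → ℝ) → ℝ) (φ : Fin (d + 1) → ℝ) (y : Fin d → ℝ) : ℝ :=
  ⨆ l : Fin (d + 1), (topDualNorm N l y - φ l)

theorem le_envelope (N : (Fin d → ℝ) → ℝ) (φ : Fin (d + 1) → ℝ) (y : Fin d → ℝ)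
    (l : Fin (d + 1)) : topDualNorm N l y - φ l ≤ envelope N φ y :=
  le_ciSup (f := fun l : Fin (d + 1) => topDualNorm N l y - φ l) (Set.finite_range _).bddAbove l

theorem exists_envelope_eq (N : (Fin d → ℝ) → ℝ) (φ : Fin (d + 1) → ℝ) (y : Fin d → ℝ) :
    ∃ l : Fin (d + 1), topDualNorm N l y - φ l = envelope N φ y :=
  exists_eq_ciSup_of_finite (f := fun l : Fin (d + 1) => topDualNorm N l y - φ l)

theorem coe_envelope (N : (Fin d → ℝ) → ℝ) (φ : Fin (d + 1) → ℝ) (y : Fin d → ℝ) :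
    ((envelope N φ y : ℝ) : EReal) =
      ⨆ l : Fin (d + 1), ((topDualNorm N l y - φ l : ℝ) : EReal) := by
  refine le_antisymm ?_ (iSup_le fun l => EReal.coe_le_coe_iff.2 (le_envelope N φ y l))
  obtain ⟨l, hl⟩ := exists_envelope_eq N φ y
  rw [← hl]
  exact le_iSup (fun l : Fin (d + 1) => ((topDualNorm N l y - φ l : ℝ) : EReal)) l

theorem envelope_nonneg (hN : IsNorm N) (hφ : φ 0 = 0) (y : Fin d → ℝ) :
    0 ≤ envelope N φ y := by
  simpa [topDualNorm_zero hN, hφ] using le_envelope N φ y 0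

theorem coupling_eq (N : (Fin d → ℝ) → ℝ) (x y : Fin d → ℝ) :
    coupling N x y = scalarProduct (normalization N x) y := by
  by_cases hx : x = 0
  · simp [coupling, normalization, hx]
  · simp [coupling, normalization, hx, smul_scalarProduct, div_eq_inv_mul]

theorem conjugate_coupling (hN : IsNorm N) (hmono : OrthantStrictlyMonotonic N)
    (hφ : Monotone φ) (y : Fin d → ℝ) :
    conjugate (coupling N) (phiLzero φ) y = ((envelope N φ y : ℝ) : EReal) := by
  have hterm : ∀ x, ((coupling N x y : EReal) + -(phiLzero φ x)) =
      ((coupling N x y - φ (lzero x) : ℝ) : EReal) := fun x => by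
    rw [EReal.coe_sub, sub_eq_add_neg, phiLzero]
  refine le_antisymm (iSup_le fun x => ?_) ?_
  · rw [hterm, EReal.coe_le_coe_iff]
    refine le_trans ?_ (le_envelope N φ y (lzero x))
    gcongr
    rcases eq_or_ne x 0 with rfl | hx
    · simp [coupling, lzero_zero, topDualNorm_zero hN]
    · have hx' := hN.pos hx
      rw [coupling, if_neg hx, div_le_iff₀ hx', ← restrict_support x, restrict_scalarProduct,
        restrict_support x, mul_comm]
      refine (hN.scalarProduct_le x _).trans ?_
      gcongr
      exact dualNorm_restrict_le_topDualNorm le_rfl y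
  · obtain ⟨l, hl⟩ := exists_envelope_eq N φ y
    obtain ⟨x, hx, hxl, hxy⟩ := exists_sparse_topDualNorm_eq hN hmono l y
    have key : ∀ x, lzero x ≤ l → topDualNorm N l y ≤ coupling N x y →
        ((envelope N φ y : ℝ) : EReal) ≤ conjugate (coupling N) (phiLzero φ) y := by
      intro x hxl hxy
      refine le_trans ?_ (le_iSup _ x)
      rw [hterm, EReal.coe_le_coe_iff, ← hl]
      linarith [hφ hxl]
    -- If the top norm is not positive the maximizer may be `0`, which cannot be normalized; the
    -- point `0`, with coupling `0`, does the job. Otherwise dividing a positive product by `N x ≤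
    -- 1` does not decrease it.
    by_cases h0 : topDualNorm N l y ≤ 0
    · exact key 0 (by simp [lzero_zero]) (by simpa [coupling] using h0)
    · push Not at h0
      have hx0 : x ≠ 0 := by
        rintro rfl
        simp at hxy
        linarith
      have hx' := hN.pos hx0
      refine key x hxl ?_
      rw [coupling, if_neg hx0, le_div_iff₀ hx', hxy]
      nlinarith

/-! ### `L` as a supremum of affine functions -/

theorem reverseFenchel_coe (g : (Fin d → ℝ) → ℝ) (x : Fin d → ℝ) :
    reverseFenchel (fun y => ((g y : ℝ) : EReal)) x =
      ⨆ y, ((scalarProduct x y - g y : ℝ) : EReal) := by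
  simp only [reverseFenchel, conjugate, EReal.coe_sub]
  rfl

theorem calL_eq_reverseFenchel (hN : IsNorm N) (hmono : OrthantStrictlyMonotonic N)
    (hφ : Monotone φ) :
    calL N φ = reverseFenchel (fun y => ((envelope N φ y : ℝ) : EReal)) := by
  rw [calL, funext (conjugate_coupling hN hmono hφ)]

theorem calL_eq (hN : IsNorm N) (hmono : OrthantStrictlyMonotonic N) (hφ : Monotone φ)
    (x : Fin d → ℝ) :
    calL N φ x = ⨆ y, ((scalarProduct x y - envelope N φ y : ℝ) : EReal) := by
  rw [calL_eq_reverseFenchel hN hmono hφ, reverseFenchel_coe]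

theorem calL_le_iff (hN : IsNorm N) (hmono : OrthantStrictlyMonotonic N) (hφ : Monotone φ)
    {x : Fin d → ℝ} {t : ℝ} :
    calL N φ x ≤ (t : EReal) ↔ ∀ y, scalarProduct x y - envelope N φ y ≤ t := by
  simp only [calL_eq hN hmono hφ, iSup_le_iff, EReal.coe_le_coe_iff]

theorem isConvex_calL (hN : IsNorm N) (hmono : OrthantStrictlyMonotonic N) (hφ : Monotone φ) :
    IsConvex (calL N φ) := by
  rintro ⟨x, s⟩ hx ⟨x', s'⟩ hx' a b ha hb hab
  simp only [Set.mem_ofPred_eq, Prod.smul_mk, Prod.mk_add_mk,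
    calL_le_iff hN hmono hφ] at hx hx' ⊢
  intro y
  rw [add_scalarProduct, smul_scalarProduct, smul_scalarProduct, smul_eq_mul, smul_eq_mul]
  have h1 := mul_le_mul_of_nonneg_left (hx y) ha
  have h2 := mul_le_mul_of_nonneg_left (hx' y) hb
  have h3 : envelope N φ y = a * envelope N φ y + b * envelope N φ y := by
    rw [← add_mul, hab, one_mul]
  linarith

theorem lowerSemicontinuous_calL (hN : IsNorm N) (hmono : OrthantStrictlyMonotonic N)
    (hφ : Monotone φ) : LowerSemicontinuous (calL N φ) := by
  rw [funext (calL_eq hN hmono hφ)]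
  refine lowerSemicontinuous_iSup fun y => Continuous.lowerSemicontinuous ?_
  exact continuous_coe_real_ereal.comp ((continuous_scalarProduct_left y).sub continuous_const)

theorem envelope_zero (hN : IsNorm N) (hφ_nonneg : ∀ k, 0 ≤ φ k) (hφ : φ 0 = 0) :
    envelope N φ 0 = 0 := by
  refine le_antisymm ?_ (envelope_nonneg hN hφ 0)
  obtain ⟨l, hl⟩ := exists_envelope_eq N φ 0
  have := topDualNorm_smul_of_nonneg hN l le_rfl (0 : Fin d → ℝ)
  rw [zero_smul, zero_mul] at this
  rw [← hl, this]
  linarith [hφ_nonneg l]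

theorem calL_nonneg (hN : IsNorm N) (hmono : OrthantStrictlyMonotonic N) (hφ : Monotone φ)
    (hφ_nonneg : ∀ k, 0 ≤ φ k) (hφ_zero : φ 0 = 0) (x : Fin d → ℝ) : 0 ≤ calL N φ x := by
  rw [calL_eq hN hmono hφ]
  refine le_trans ?_ (le_iSup _ 0)
  simp [envelope_zero hN hφ_nonneg hφ_zero]

theorem calL_le_of_mem_supportBall (hN : IsNorm N) (hmono : OrthantStrictlyMonotonic N)
    (hφ : Monotone φ) {l : Fin (d + 1)} {x : Fin d → ℝ} (hx : x ∈ supportBall N l) :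
    calL N φ x ≤ (φ l : EReal) :=
  (calL_le_iff hN hmono hφ).2 fun y => by
    linarith [scalarProduct_le_topDualNorm hN hx y, le_envelope N φ y l]

theorem calL_zero (hN : IsNorm N) (hmono : OrthantStrictlyMonotonic N) (hφ : Monotone φ)
    (hφ_nonneg : ∀ k, 0 ≤ φ k) (hφ_zero : φ 0 = 0) : calL N φ 0 = 0 := by
  refine le_antisymm ?_ (calL_nonneg hN hmono hφ hφ_nonneg hφ_zero 0)
  simpa [hφ_zero] using calL_le_of_mem_supportBall hN hmono hφ (l := 0) (x := 0)
    (by simp [supportBall])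

theorem isProper_calL (hN : IsNorm N) (hmono : OrthantStrictlyMonotonic N) (hφ : Monotone φ)
    (hφ_nonneg : ∀ k, 0 ≤ φ k) (hφ_zero : φ 0 = 0) : IsProper (calL N φ) :=
  ⟨fun x => ((EReal.bot_lt_zero).trans_le
    (calL_nonneg hN hmono hφ hφ_nonneg hφ_zero x)).ne',
    0, by simp [calL_zero hN hmono hφ hφ_nonneg hφ_zero]⟩

end

/-! ### Duality between `L` and the decompositions -/

section

variable {d : ℕ} {N : (Fin d → ℝ) → ℝ} {φ : Fin (d + 1) → ℝ}

/-- The cost `∑_{l=1}^d φ(l) ‖x^(l)‖` of a decomposition. -/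
noncomputable def decompositionCost (N : (Fin d → ℝ) → ℝ) (φ : Fin (d + 1) → ℝ)
    (z : Fin d → Fin d → ℝ) : ℝ :=
  ∑ l : Fin d, φ l.succ * supportDualNorm N (l + 1) (z l)

/-- The epigraph of the minimal cost of a decomposition. -/
def decompositionEpigraph (N : (Fin d → ℝ) → ℝ) (φ : Fin (d + 1) → ℝ) :
    Set ((Fin d → ℝ) × ℝ) :=
  {p | ∃ z ∈ decompositions N p.1, decompositionCost N φ z ≤ p.2}

theorem scalarProduct_le_supportDualNorm_mul (hN : IsNorm N) (k : ℕ) (x y : Fin d → ℝ) :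
    scalarProduct x y ≤ supportDualNorm N (k + 1) x * topDualNorm N (k + 1) y := by
  rw [supportDualNorm_succ, scalarProduct_comm, mul_comm]
  exact (isNorm_topDualNorm hN k).scalarProduct_le y x

theorem scalarProduct_le_sum (hN : IsNorm N) {x : Fin d → ℝ} {z : Fin d → Fin d → ℝ}
    (hz : z ∈ decompositions N x) (y : Fin d → ℝ) : scalarProduct x y ≤
      ∑ l : Fin d, supportDualNorm N (l + 1) (z l) * topDualNorm N (l + 1) y := by
  rw [← hz.2, sum_scalarProduct]
  exact Finset.sum_le_sum fun l _ => scalarProduct_le_supportDualNorm_mul hN l _ y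

/-- Weak duality: bound each top-`l` norm of `y` by `E(y) + φ(l)`. The mass multiplying `E(y)` is at
most one, and `E(y) ≥ 0` thanks to the level `l = 0`. -/
theorem calL_le_decompositionCost (hN : IsNorm N) (hmono : OrthantStrictlyMonotonic N)
    (hφ : Monotone φ) (hφ_zero : φ 0 = 0) {x : Fin d → ℝ} {z : Fin d → Fin d → ℝ}
    (hz : z ∈ decompositions N x) : calL N φ x ≤ (decompositionCost N φ z : EReal) := by
  refine (calL_le_iff hN hmono hφ).2 fun y => ?_
  have hE := envelope_nonneg hN hφ_zero y
  have h1 := scalarProduct_le_sum hN hz y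
  have h2 : ∑ l : Fin d, supportDualNorm N (l + 1) (z l) * topDualNorm N (l + 1) y ≤
      ∑ l : Fin d, (supportDualNorm N (l + 1) (z l) * envelope N φ y +
        φ l.succ * supportDualNorm N (l + 1) (z l)) := by
    refine Finset.sum_le_sum fun l _ => ?_
    have h3 := le_envelope N φ y l.succ
    rw [Fin.val_succ] at h3
    have h4 := (isNorm_supportDualNorm hN l).nonneg (z l)
    nlinarith
  rw [Finset.sum_add_distrib, ← Finset.sum_mul] at h2
  have h5 := mul_le_mul_of_nonneg_right hz.1 hE
  rw [decompositionCost]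
  linarith

theorem continuous_supportDualNorm_comp (hN : IsNorm N) (l : Fin d) :
    Continuous fun z : Fin d → Fin d → ℝ => supportDualNorm N (l + 1) (z l) :=
  (isNorm_supportDualNorm hN l).continuous.comp (continuous_apply l)

theorem continuous_decompositionCost (hN : IsNorm N) (φ : Fin (d + 1) → ℝ) :
    Continuous (decompositionCost N φ) :=
  continuous_finsetSum _ fun l _ => continuous_const.mul (continuous_supportDualNorm_comp hN l)

theorem isCompact_sum_supportDualNorm_le (hN : IsNorm N) :
    IsCompact {z : Fin d → Fin d → ℝ | ∑ l : Fin d, supportDualNorm N (l + 1) (z l) ≤ 1} := by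
  refine (isCompact_univ_pi fun l : Fin d =>
    (isNorm_supportDualNorm hN l).isCompact_ball 1).of_isClosed_subset
    (isClosed_le (continuous_finsetSum _ fun l _ => continuous_supportDualNorm_comp hN l)
      continuous_const) fun z hz l _ => ?_
  exact (Finset.single_le_sum
    (f := fun l : Fin d => supportDualNorm N (l + 1) (z l))
    (fun l _ => (isNorm_supportDualNorm hN l).nonneg _) (Finset.mem_univ l)).trans hz

theorem continuous_sum_apply : Continuous fun z : Fin d → Fin d → ℝ => ∑ l, z l :=
  continuous_finsetSum _ fun l _ => continuous_apply l

theorem isCompact_decompositions (hN : IsNorm N) (x : Fin d → ℝ) :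
    IsCompact (decompositions N x) :=
  (isCompact_sum_supportDualNorm_le hN).inter_right
    (isClosed_eq continuous_sum_apply continuous_const)

/-- The epigraph is the projection of a closed set along a compact factor, the decompositions of
total norm at most one. -/
theorem isClosed_decompositionEpigraph (hN : IsNorm N) (φ : Fin (d + 1) → ℝ) :
    IsClosed (decompositionEpigraph N φ) := by
  have := isCompact_iff_compactSpace.1 (isCompact_sum_supportDualNorm_le hN)
  have hcl : IsClosed {q : {z : Fin d → Fin d → ℝ |
      ∑ l : Fin d, supportDualNorm N (l + 1) (z l) ≤ 1} × ((Fin d → ℝ) × ℝ) |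
      ∑ l, q.1.1 l = q.2.1 ∧ decompositionCost N φ q.1.1 ≤ q.2.2} :=
    (isClosed_eq (continuous_sum_apply.comp (continuous_subtype_val.comp continuous_fst))
      (continuous_fst.comp continuous_snd)).inter
    (isClosed_le ((continuous_decompositionCost hN φ).comp
      (continuous_subtype_val.comp continuous_fst)) (continuous_snd.comp continuous_snd))
  convert isClosedMap_snd_of_compactSpace _ hcl using 1
  ext p
  constructor
  · rintro ⟨z, hz, h⟩
    exact ⟨(⟨z, hz.1⟩, p), ⟨hz.2, h⟩, rfl⟩
  · rintro ⟨⟨⟨z, hz⟩, p'⟩, ⟨h1, h2⟩, rfl⟩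
    exact ⟨z, ⟨hz, h1⟩, h2⟩

theorem convex_decompositionEpigraph (hN : IsNorm N) (hφ_nonneg : ∀ k, 0 ≤ φ k) :
    Convex ℝ (decompositionEpigraph N φ) := by
  rintro ⟨x, s⟩ ⟨z, ⟨hz, hzx⟩, hzs⟩ ⟨x', s'⟩ ⟨z', ⟨hz', hzx'⟩, hzs'⟩ a b ha hb hab
  have hσ : ∀ l : Fin d, supportDualNorm N (l + 1) ((a • z + b • z') l) ≤
      a * supportDualNorm N (l + 1) (z l) + b * supportDualNorm N (l + 1) (z' l) := fun l => by
    have h := isNorm_supportDualNorm hN l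
    rw [← h.smul_of_nonneg ha, ← h.smul_of_nonneg hb]
    exact h.add_le _ _
  refine ⟨a • z + b • z', ⟨?_, ?_⟩, ?_⟩
  · refine (Finset.sum_le_sum fun l _ => hσ l).trans ?_
    rw [Finset.sum_add_distrib, ← Finset.mul_sum, ← Finset.mul_sum]
    nlinarith
  · simp only [Pi.add_apply, Pi.smul_apply, Finset.sum_add_distrib, ← Finset.smul_sum, hzx, hzx',
      Prod.smul_mk, Prod.mk_add_mk]
  · have h : decompositionCost N φ (a • z + b • z') ≤
        a * decompositionCost N φ z + b * decompositionCost N φ z' := by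
      simp only [decompositionCost, Finset.mul_sum, ← Finset.sum_add_distrib]
      refine Finset.sum_le_sum fun l _ => ?_
      nlinarith [mul_le_mul_of_nonneg_left (hσ l) (hφ_nonneg l.succ)]
    simp only [Prod.smul_mk, Prod.mk_add_mk, smul_eq_mul] at hzs hzs' ⊢
    nlinarith

theorem zero_mem_decompositionEpigraph (hN : IsNorm N) {r : ℝ} (hr : 0 ≤ r) :
    ((0 : Fin d → ℝ), r) ∈ decompositionEpigraph N φ := by
  have h : ∀ l : Fin d, supportDualNorm N (l + 1) ((0 : Fin d → Fin d → ℝ) l) = 0 := fun l =>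
    (isNorm_supportDualNorm hN l).map_zero
  refine ⟨0, ⟨?_, by simp⟩, ?_⟩
  · simp only [h, Finset.sum_const_zero, zero_le_one]
  · simpa only [decompositionCost, h, mul_zero, Finset.sum_const_zero] using hr

theorem mem_decompositionEpigraph (hN : IsNorm N) (hφ_nonneg : ∀ k, 0 ≤ φ k)
    {l : Fin (d + 1)} {x : Fin d → ℝ} (hx : x ∈ supportBall N l) :
    (x, φ l) ∈ decompositionEpigraph N φ := by
  induction l using Fin.cases with
  | zero =>
    obtain rfl : x = 0 := by simpa [supportBall] using hx
    exact zero_mem_decompositionEpigraph hN (hφ_nonneg 0)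
  | succ l =>
    rw [Fin.val_succ, mem_supportBall_succ] at hx
    have h : ∀ k ≠ l, (Pi.single l x : Fin d → Fin d → ℝ) k = 0 := fun k hk =>
      Pi.single_eq_of_ne (M := fun _ : Fin d => Fin d → ℝ) hk x
    have h' : ∀ k ≠ l, supportDualNorm N (k + 1)
        ((Pi.single l x : Fin d → Fin d → ℝ) k) = 0 := fun k hk => by
      rw [h k hk, (isNorm_supportDualNorm hN k).map_zero]
    refine ⟨Pi.single l x, ⟨?_, ?_⟩, ?_⟩
    · rw [Fintype.sum_eq_single l h', Pi.single_eq_same]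
      exact hx
    · rw [Fintype.sum_eq_single l h, Pi.single_eq_same]
    · rw [decompositionCost, Fintype.sum_eq_single l fun k hk => by rw [h' k hk, mul_zero],
        Pi.single_eq_same]
      exact mul_le_of_le_one_right (hφ_nonneg _) hx

/-- Strong duality: outside of the epigraph of the minimal cost, some affine minorant is larger. -/
theorem exists_lt_of_notMem_decompositionEpigraph (hN : IsNorm N)
    (hmono : OrthantStrictlyMonotonic N) (hφ_nonneg : ∀ k, 0 ≤ φ k) {x : Fin d → ℝ} {t : ℝ}
    (hxt : (x, t) ∉ decompositionEpigraph N φ) :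
    ∃ y, t < scalarProduct x y - envelope N φ y := by
  obtain ⟨f, u, hf, hu⟩ := geometric_hahn_banach_closed_point
    (convex_decompositionEpigraph hN hφ_nonneg) (isClosed_decompositionEpigraph hN φ) hxt
  obtain ⟨y, s, hys⟩ : ∃ (y : Fin d → ℝ) (s : ℝ), ∀ p, f p = scalarProduct p.1 y + s * p.2 := by
    refine ⟨fun i => (f.toLinearMap ∘ₗ LinearMap.inl ℝ _ ℝ) (Pi.single i 1), f (0, 1),
      fun p => ?_⟩
    rw [scalarProduct_linearMap, mul_comm, ← smul_eq_mul, ← map_smul]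
    simp [← map_add]
  rw [hys] at hu
  have hs : s ≤ 0 := by
    have h0 : 0 < u := by
      simpa [hys] using hf _ (zero_mem_decompositionEpigraph hN le_rfl)
    -- The epigraph contains the upward ray over `0`; with `s > 0`, its point at height `u / s`
    -- would take the value `u`, which is excluded.
    by_contra! hs
    have := hf _ (zero_mem_decompositionEpigraph (r := u / s) hN (by positivity))
    simp [hys, mul_div_cancel₀ _ hs.ne'] at this
  -- The separation is tested at `(b, φ l)`, where the sparse vector `b` attains the top-`l` norm of
  -- `y`.
  have hT : ∀ l : Fin (d + 1), topDualNorm N l y + s * φ l < u := fun l => by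
    obtain ⟨b, hb, hbl, hby⟩ := exists_sparse_topDualNorm_eq hN hmono l y
    rw [← hby]
    simpa only [hys] using hf _ (mem_decompositionEpigraph hN hφ_nonneg
      (mem_supportBall_of_lzero_le hN hb hbl))
  dsimp only at hu
  rcases hs.lt_or_eq with hs | rfl
  · refine ⟨(-s)⁻¹ • y, ?_⟩
    obtain ⟨l, hl⟩ := exists_envelope_eq N φ ((-s)⁻¹ • y)
    have hs' : 0 < (-s)⁻¹ := inv_pos.2 (neg_pos.2 hs)
    have hss : (-s)⁻¹ * s = -1 := by
      rw [inv_neg, neg_mul, inv_mul_cancel₀ hs.ne]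
    rw [← hl, topDualNorm_smul_of_nonneg hN _ hs'.le, scalarProduct_smul]
    have := mul_lt_mul_of_pos_left ((hT l).trans hu) hs'
    rw [mul_add, mul_add, ← mul_assoc, ← mul_assoc, hss] at this
    linarith
  · simp only [zero_mul, add_zero] at hu hT
    have hpos : 0 < scalarProduct x y - u := sub_pos.2 hu
    -- Vertical hyperplane: `⟨x, y⟩` exceeds `u`, which exceeds all top norms of `y`. This multiple
    -- makes the gap equal to `|t| + 1 > t`, and subtracting `φ(l) ≥ 0` from the top norm only
    -- helps.
    refine ⟨((|t| + 1) / (scalarProduct x y - u)) • y, ?_⟩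
    set c := (|t| + 1) / (scalarProduct x y - u) with hc
    have hc0 : 0 ≤ c := by positivity
    have hcu : c * (scalarProduct x y - u) = |t| + 1 := div_mul_cancel₀ _ hpos.ne'
    obtain ⟨l, hl⟩ := exists_envelope_eq N φ (c • y)
    rw [← hl, topDualNorm_smul_of_nonneg hN _ hc0, scalarProduct_smul]
    have h1 := mul_le_mul_of_nonneg_left (hT l).le hc0
    have h2 := hφ_nonneg l
    have h3 := le_abs_self t
    linarith

theorem isMinOver_decompositions (hN : IsNorm N) (hmono : OrthantStrictlyMonotonic N)
    (hφ : Monotone φ) (hφ_nonneg : ∀ k, 0 ≤ φ k) (hφ_zero : φ 0 = 0) (x : Fin d → ℝ) :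
    IsMinOver (decompositions N x) (decompositionCost N φ) (calL N φ x) := by
  have hlt : ∀ t : ℝ, (x, t) ∉ decompositionEpigraph N φ → (t : EReal) < calL N φ x :=
    fun t ht => by
      obtain ⟨y, hy⟩ := exists_lt_of_notMem_decompositionEpigraph hN hmono hφ_nonneg ht
      rw [calL_eq hN hmono hφ]
      exact (EReal.coe_lt_coe_iff.2 hy).trans_le
        (le_iSup (fun y => ((scalarProduct x y - envelope N φ y : ℝ) : EReal)) y)
  rcases (decompositions N x).eq_empty_or_nonempty with h | h
  · refine ⟨?_, fun h' => absurd h h'.ne_empty⟩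
    simp only [h, Set.mem_empty_iff_false, iInf_false, iInf_top]
    refine (EReal.eq_top_iff_forall_lt _).2 fun t => hlt t ?_
    rintro ⟨z, hz, -⟩
    exact Set.notMem_empty z (h ▸ hz)
  · obtain ⟨z, hz, hmin⟩ := (isCompact_decompositions hN x).exists_isMinOn h
      (continuous_decompositionCost hN φ).continuousOn
    have heq : calL N φ x = (decompositionCost N φ z : EReal) := by
      refine (calL_le_decompositionCost hN hmono hφ hφ_zero hz).antisymm ?_
      -- A level `t` below the minimal cost is outside the epigraph, so strong duality puts `L(x)`
      -- above it.
      refine EReal.ge_of_forall_gt_iff_ge.1 fun t ht => (hlt t ?_).le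
      rintro ⟨z', hz', hz't⟩
      exact (EReal.coe_lt_coe_iff.1 ht).not_ge ((hmin hz').trans hz't)
    refine ⟨le_antisymm (le_iInf₂ fun z hz => calL_le_decompositionCost hN hmono hφ hφ_zero hz) ?_,
      fun _ => ⟨z, hz, heq⟩⟩
    rw [heq]
    exact iInf₂_le z hz

end

section

variable {d : ℕ} {N : (Fin d → ℝ) → ℝ} {φ : Fin (d + 1) → ℝ}

/-! ### The other variational expressions -/

/-- The two directions are asymmetric: equal costs from `S` to `T` carry a minimizer over, while
from `T` to `S` it is enough not to increase the cost. -/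
theorem IsMinOver.transfer {α β : Type*} {S : Set α} {T : Set β} {c : α → ℝ} {c' : β → ℝ}
    {a : EReal} (h : IsMinOver S c a) (hST : ∀ s ∈ S, ∃ t ∈ T, c' t = c s)
    (hTS : ∀ t ∈ T, ∃ s ∈ S, c s ≤ c' t) : IsMinOver T c' a := by
  have hle : ∀ t ∈ T, a ≤ (c' t : EReal) := fun t ht => by
    obtain ⟨s, hs, hst⟩ := hTS t ht
    rw [h.1]
    exact (iInf₂_le s hs).trans (EReal.coe_le_coe_iff.2 hst)
  have hex : T.Nonempty → ∃ t ∈ T, a = (c' t : EReal) := by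
    rintro ⟨t, ht⟩
    obtain ⟨s, hs, -⟩ := hTS t ht
    obtain ⟨s, hs, has⟩ := h.2 ⟨s, hs⟩
    obtain ⟨t, ht, hts⟩ := hST s hs
    exact ⟨t, ht, by rw [has, hts]⟩
  refine ⟨le_antisymm (le_iInf₂ hle) ?_, hex⟩
  rcases T.eq_empty_or_nonempty with hT | hT
  · rcases S.eq_empty_or_nonempty with hS | ⟨s, hs⟩
    · rw [h.1]
      simp [hS]
    · obtain ⟨t, ht, -⟩ := hST s hs
      exact absurd hT (Set.Nonempty.ne_empty ⟨t, ht⟩)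
  · obtain ⟨t, ht, hat⟩ := hex hT
    rw [hat]
    exact iInf₂_le t ht

theorem IsNorm.exists_eq_one (hd : 0 < d) (hN : IsNorm N) : ∃ x, N x = 1 := by
  have hne : (Pi.single ⟨0, hd⟩ 1 : Fin d → ℝ) ≠ 0 := by simp
  have hpos := hN.pos hne
  exact ⟨(N (Pi.single ⟨0, hd⟩ 1))⁻¹ • Pi.single ⟨0, hd⟩ 1, by
    rw [hN.smul_of_nonneg (by positivity), inv_mul_cancel₀ hpos.ne']⟩

/-- For `x = 0` an arbitrary unit vector is needed, hence `0 < d`. This is what lets spheres replace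
balls even when a piece vanishes. -/
theorem IsNorm.exists_smul_eq (hd : 0 < d) (hN : IsNorm N) (x : Fin d → ℝ) :
    ∃ s, N s = 1 ∧ N x • s = x := by
  rcases eq_or_ne x 0 with rfl | hx
  · obtain ⟨s, hs⟩ := hN.exists_eq_one hd
    exact ⟨s, hs, by rw [hN.map_zero, zero_smul]⟩
  · have hpos := hN.pos hx
    exact ⟨(N x)⁻¹ • x, by rw [hN.smul_of_nonneg (by positivity), inv_mul_cancel₀ hpos.ne'],
      smul_inv_smul₀ hpos.ne' x⟩

theorem simplexFeasible_mono {B C : ℕ → Set (Fin d → ℝ)} (h : ∀ l, B l ⊆ C l) (x : Fin d → ℝ) :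
    simplexFeasible B x ⊆ simplexFeasible C x := by
  rintro w ⟨hw, hx⟩
  refine ⟨hw, ?_⟩
  rw [Set.mem_fintype_sum] at hx ⊢
  obtain ⟨z, hz, rfl⟩ := hx
  exact ⟨z, fun l => Set.smul_set_mono (h _) (hz l), rfl⟩

theorem exists_simplexFeasible_supportSphere (hd : 0 < d) (hN : IsNorm N) {x : Fin d → ℝ}
    {z : Fin d → Fin d → ℝ} (hz : z ∈ decompositions N x) :
    ∃ w ∈ simplexFeasible (supportSphere N) x,
      ∑ l : Fin d, w l.succ * φ l.succ = decompositionCost N φ z := by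
  -- The weight of level `l` is the norm of the piece; the unused mass goes to the free index `0`.
  refine ⟨Fin.cons (1 - ∑ l : Fin d, supportDualNorm N (l + 1) (z l))
    fun l : Fin d => supportDualNorm N (l + 1) (z l), ⟨⟨fun l => ?_, ?_⟩, ?_⟩, ?_⟩
  · induction l using Fin.cases with
    | zero => simpa using hz.1
    | succ l => simpa using (isNorm_supportDualNorm hN l).nonneg (z l)
  · simp [Fin.sum_univ_succ]
  · rw [Set.mem_fintype_sum]
    refine ⟨z, fun l => ?_, hz.2⟩
    obtain ⟨s, hs, hsz⟩ := (isNorm_supportDualNorm hN l).exists_smul_eq hd (z l)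
    rw [Fin.cons_succ]
    exact ⟨s, mem_supportSphere_succ.2 hs, hsz⟩
  · simp only [Fin.cons_succ, decompositionCost, mul_comm]

theorem exists_decomposition_of_simplexFeasible (hN : IsNorm N) (hφ_nonneg : ∀ k, 0 ≤ φ k)
    {x : Fin d → ℝ} {w : Fin (d + 1) → ℝ} (hw : w ∈ simplexFeasible (supportBall N) x) :
    ∃ z ∈ decompositions N x, decompositionCost N φ z ≤ ∑ l : Fin d, w l.succ * φ l.succ := by
  obtain ⟨⟨hw0, hw1⟩, hx⟩ := hw
  rw [Set.mem_fintype_sum] at hx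
  obtain ⟨z, hz, hzx⟩ := hx
  have hle : ∀ l : Fin d, supportDualNorm N (l + 1) (z l) ≤ w l.succ := fun l => by
    obtain ⟨b, hb, hbz⟩ := hz l
    rw [← hbz]
    beta_reduce
    rw [(isNorm_supportDualNorm hN l).smul_of_nonneg (hw0 _)]
    exact mul_le_of_le_one_right (hw0 _) (mem_supportBall_succ.1 hb)
  refine ⟨z, ⟨(Finset.sum_le_sum fun l _ => hle l).trans ?_, hzx⟩,
    Finset.sum_le_sum fun l _ => ?_⟩
  · rw [Fin.sum_univ_succ] at hw1
    linarith [hw0 0]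
  · rw [mul_comm]
    exact mul_le_mul_of_nonneg_right (hle l) (hφ_nonneg _)

theorem isMinOver_supportBall (hd : 0 < d) (hN : IsNorm N) (hmono : OrthantStrictlyMonotonic N)
    (hφ : Monotone φ) (hφ_nonneg : ∀ k, 0 ≤ φ k) (hφ_zero : φ 0 = 0) (x : Fin d → ℝ) :
    IsMinOver (simplexFeasible (supportBall N) x)
      (fun w => ∑ l : Fin d, w l.succ * φ l.succ) (calL N φ x) := by
  refine (isMinOver_decompositions hN hmono hφ hφ_nonneg hφ_zero x).transfer (fun z hz => ?_)
    fun w hw => exists_decomposition_of_simplexFeasible hN hφ_nonneg hw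
  obtain ⟨w, hw, h⟩ := exists_simplexFeasible_supportSphere hd hN (φ := φ) hz
  exact ⟨w, simplexFeasible_mono (supportSphere_subset_supportBall N) x hw, h⟩

theorem isMinOver_supportSphere (hd : 0 < d) (hN : IsNorm N) (hmono : OrthantStrictlyMonotonic N)
    (hφ : Monotone φ) (hφ_nonneg : ∀ k, 0 ≤ φ k) (hφ_zero : φ 0 = 0) (x : Fin d → ℝ) :
    IsMinOver (simplexFeasible (supportSphere N) x)
      (fun w => ∑ l : Fin d, w l.succ * φ l.succ) (calL N φ x) :=
  (isMinOver_decompositions hN hmono hφ hφ_nonneg hφ_zero x).transfer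
    (fun _ hz => exists_simplexFeasible_supportSphere hd hN hz)
    fun _ hw => exists_decomposition_of_simplexFeasible hN hφ_nonneg
      (simplexFeasible_mono (supportSphere_subset_supportBall N) x hw)

/-! ### Step functions -/

theorem le_stepFunction_iff {B : ℕ → Set (Fin d → ℝ)} {x : Fin d → ℝ} {a : EReal} :
    a ≤ stepFunction B φ x ↔ ∀ l : Fin (d + 1), x ∈ B l → a ≤ (φ l : EReal) := by
  rw [stepFunction, le_iInf_iff]
  refine forall_congr' fun l => ?_
  by_cases h : x ∈ B l <;> simp [indicator, h]

theorem stepFunction_le {B : ℕ → Set (Fin d → ℝ)} {x : Fin d → ℝ} {l : Fin (d + 1)}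
    (h : x ∈ B l) : stepFunction B φ x ≤ (φ l : EReal) :=
  le_stepFunction_iff.1 le_rfl l h

theorem stepFunction_anti {B C : ℕ → Set (Fin d → ℝ)} (h : ∀ l, B l ⊆ C l) :
    stepFunction C φ ≤ stepFunction B φ := fun _ =>
  le_stepFunction_iff.2 fun l hl => stepFunction_le (h l hl)

theorem stepFunction_eq_sInf (B : ℕ → Set (Fin d → ℝ)) (φ : Fin (d + 1) → ℝ) (x : Fin d → ℝ) :
    stepFunction B φ x =
      sInf ((fun l : Fin (d + 1) => (φ l : EReal)) '' {l | x ∈ B l}) :=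
  eq_of_forall_le_iff fun a => by
    simp [le_stepFunction_iff, sInf_image]

theorem stepFunction_supportBall_eq (hN : IsNorm N) (hφ : Monotone φ) {l : Fin d}
    {x : Fin d → ℝ} (hx : x ∈ supportBall N (l + 1) \ supportBall N l) :
    stepFunction (supportBall N) φ x = (φ l.succ : EReal) := by
  refine le_antisymm (stepFunction_le hx.1) (le_stepFunction_iff.2 fun k hk => ?_)
  refine EReal.coe_le_coe_iff.2 (hφ ?_)
  by_contra h
  rw [not_le, Fin.lt_def, Fin.val_succ] at h
  exact hx.2 (supportBall_mono hN (Nat.lt_succ_iff.1 h) hk)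

theorem stepFunction_supportBall_zero (N : (Fin d → ℝ) → ℝ) (hφ_nonneg : ∀ k, 0 ≤ φ k)
    (hφ_zero : φ 0 = 0) : stepFunction (supportBall N) φ 0 = 0 := by
  refine le_antisymm ?_ (le_stepFunction_iff.2 fun l _ => EReal.coe_nonneg.2 (hφ_nonneg l))
  simpa [hφ_zero] using stepFunction_le (φ := φ) (B := supportBall N) (x := 0) (l := 0)
    (by simp [supportBall])

theorem stepFunction_supportBall_eq_top (hN : IsNorm N) {x : Fin d → ℝ}
    (hx : x ∉ supportBall N d) : stepFunction (supportBall N) φ x = ⊤ :=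
  top_le_iff.1 (le_stepFunction_iff.2 fun l hl =>
    absurd (supportBall_mono hN (Nat.lt_succ_iff.1 l.2) hl) hx)

theorem calL_le_stepFunction (hN : IsNorm N) (hmono : OrthantStrictlyMonotonic N)
    (hφ : Monotone φ) : calL N φ ≤ stepFunction (supportBall N) φ := fun _ =>
  le_stepFunction_iff.2 fun _ hl => calL_le_of_mem_supportBall hN hmono hφ hl

/-- Jensen's inequality at optimal weights on the spheres: `x` is a convex combination of `0` and
points `s l` where `g (s l) ≤ φ(l)`, with total cost `L(x)`. -/
theorem le_calL_of_isConvex (hd : 0 < d) (hN : IsNorm N) (hmono : OrthantStrictlyMonotonic N)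
    (hφ : Monotone φ) (hφ_nonneg : ∀ k, 0 ≤ φ k) (hφ_zero : φ 0 = 0)
    {g : (Fin d → ℝ) → EReal} (hg : IsConvex g) (hgS : g ≤ stepFunction (supportSphere N) φ) :
    g ≤ calL N φ := by
  intro x
  have hmin := isMinOver_supportSphere hd hN hmono hφ hφ_nonneg hφ_zero x
  rcases (simplexFeasible (supportSphere N) x).eq_empty_or_nonempty with h | h
  · rw [hmin.1, h]
    simp
  obtain ⟨w, ⟨⟨hw0, hw1⟩, hx⟩, hw⟩ := hmin.2 h
  rw [Set.mem_fintype_sum] at hx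
  obtain ⟨z, hz, hzx⟩ := hx
  choose s hs hsz using hz
  -- The entry `(0, 0)` absorbs the weight of index `0`, so that the weights sum to one.
  let p : Fin (d + 1) → (Fin d → ℝ) × ℝ := Fin.cons (0, 0) fun l => (s l, φ l.succ)
  have hp : ∀ l ∈ Finset.univ, p l ∈ {p : (Fin d → ℝ) × ℝ | g p.1 ≤ (p.2 : EReal)} := fun l _ => by
    induction l using Fin.cases with
    | zero =>
      refine (hgS 0).trans ((stepFunction_le (l := 0) ?_).trans_eq ?_)
      · simp [supportSphere]
      · simp [p, hφ_zero]
    | succ l => exact (hgS (s l)).trans (stepFunction_le (l := l.succ) (hs l))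
  have hmem := hg.sum_mem (fun l _ => hw0 l) hw1 hp
  have hsum : ∑ l, w l • p l = (x, ∑ l : Fin d, w l.succ * φ l.succ) := by
    rw [Fin.sum_univ_succ]
    refine Prod.ext ?_ ?_
    · simpa [p, Prod.fst_sum, ← hzx] using Finset.sum_congr rfl fun l _ => hsz l
    · simp [p, Prod.snd_sum]
  rw [hsum] at hmem
  rw [hw]
  exact hmem

theorem isLargestConvexLscBelow_supportSphere (hd : 0 < d) (hN : IsNorm N)
    (hmono : OrthantStrictlyMonotonic N) (hφ : Monotone φ) (hφ_nonneg : ∀ k, 0 ≤ φ k)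
    (hφ_zero : φ 0 = 0) :
    IsLargestConvexLscBelow (calL N φ) (stepFunction (supportSphere N) φ) :=
  ⟨⟨isConvex_calL hN hmono hφ, lowerSemicontinuous_calL hN hmono hφ,
    (calL_le_stepFunction hN hmono hφ).trans
      (stepFunction_anti (supportSphere_subset_supportBall N))⟩,
    fun _ hg => le_calL_of_isConvex hd hN hmono hφ hφ_nonneg hφ_zero hg.1 hg.2.2⟩

theorem isLargestConvexLscBelow_supportBall (hd : 0 < d) (hN : IsNorm N)
    (hmono : OrthantStrictlyMonotonic N) (hφ : Monotone φ) (hφ_nonneg : ∀ k, 0 ≤ φ k)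
    (hφ_zero : φ 0 = 0) :
    IsLargestConvexLscBelow (calL N φ) (stepFunction (supportBall N) φ) :=
  ⟨⟨isConvex_calL hN hmono hφ, lowerSemicontinuous_calL hN hmono hφ,
    calL_le_stepFunction hN hmono hφ⟩,
    fun _ hg => le_calL_of_isConvex hd hN hmono hφ hφ_nonneg hφ_zero hg.1
      (hg.2.2.trans (stepFunction_anti (supportSphere_subset_supportBall N)))⟩

/-! ### Equality on the unit sphere -/

/-- A norming vector with the same support, for orthant-strictly monotonic norms. -/
theorem exists_norming_same_support (hN : IsNorm N) (hmono : OrthantStrictlyMonotonic N)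
    (hdual : OrthantStrictlyMonotonic (dualNorm N)) {s : Fin d → ℝ} (hs : N s = 1) :
    ∃ y, dualNorm N y ≤ 1 ∧ scalarProduct s y = 1 ∧ ∀ i, y i ≠ 0 ↔ s i ≠ 0 := by
  have hs0 : s ≠ 0 := by
    rintro rfl
    simp [hN.map_zero] at hs
  obtain ⟨y, hy, hsy⟩ := hN.exists_norming hs0
  -- Truncating the norming vector to the support of `s` preserves the pairing with `s` and does not
  -- increase the dual norm.
  set K := Finset.univ.filter fun i => s i ≠ 0 with hK
  have hKs : restrict K s = s := restrict_support s
  have hy' : dualNorm N (restrict K y) ≤ 1 := (hdual.restrict_le K y).trans hy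
  have hsy' : scalarProduct s (restrict K y) = 1 := by
    rw [← restrict_scalarProduct, hKs, hsy, hs]
  refine ⟨restrict K y, hy', hsy', fun i => ⟨fun hi h => ?_, fun hi h => ?_⟩⟩
  · simp [restrict, hK, h] at hi
  -- If the truncated `y` vanished at `i` in the support of `s`, deleting `s i` would keep the
  -- pairing equal to one but make the norm of `s` less than one.
  · have hlt := hmono.restrict_lt (K := {i}ᶜ) (i := i) (x := s) (by simp) hi
    have hres : restrict {i}ᶜ (restrict K y) = restrict K y := by
      funext j
      by_cases hj : j = i
      · subst hj
        rw [h]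
        simp [restrict]
      · simp [restrict, hj]
    have h1 := hN.scalarProduct_le (restrict {i}ᶜ s) (restrict K y)
    rw [restrict_scalarProduct, hres, hsy'] at h1
    have h2 := hN.nonneg (restrict {i}ᶜ s)
    nlinarith

/-- A set of at most `k < ℓ₀(y)` indices misses some nonzero entry of `y`, and dropping that entry
strictly lowers the dual norm. -/
theorem topDualNorm_lt_of_lt_lzero (hdual : OrthantStrictlyMonotonic (dualNorm N))
    {y : Fin d → ℝ} {k : ℕ} (hk : k < (lzero y : ℕ)) : topDualNorm N k y < dualNorm N y := by
  obtain ⟨K, hK, h⟩ := exists_topDualNorm_eq N k y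
  rw [← h]
  obtain ⟨i, hi, hiK⟩ : ∃ i ∈ Finset.univ.filter fun i => y i ≠ 0, i ∉ K :=
    Finset.exists_mem_notMem_of_card_lt_card (hK.trans_lt hk)
  exact hdual.restrict_lt hiK (Finset.mem_filter.1 hi).2

theorem topDualNorm_le_dualNorm (hdual : OrthantStrictlyMonotonic (dualNorm N)) (k : ℕ)
    (y : Fin d → ℝ) : topDualNorm N k y ≤ dualNorm N y := by
  obtain ⟨K, -, h⟩ := exists_topDualNorm_eq N k y
  exact h ▸ hdual.restrict_le K y

theorem le_decompositionCost_of_sphere (hN : IsNorm N) (hmono : OrthantStrictlyMonotonic N)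
    (hdual : OrthantStrictlyMonotonic (dualNorm N)) (hφ : Monotone φ)
    (hφ_nonneg : ∀ k, 0 ≤ φ k) {s : Fin d → ℝ} (hs : N s = 1) {z : Fin d → Fin d → ℝ}
    (hz : z ∈ decompositions N s) : φ (lzero s) ≤ decompositionCost N φ z := by
  obtain ⟨y, hy, hsy, hsupp⟩ := exists_norming_same_support hN hmono hdual hs
  have hl : lzero y = lzero s := by simp only [lzero, hsupp]
  set σ : Fin d → ℝ := fun l => supportDualNorm N (l + 1) (z l) with hσ
  have hσ0 : ∀ l, 0 ≤ σ l := fun l => (isNorm_supportDualNorm hN l).nonneg _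
  have h1 : 1 ≤ ∑ l : Fin d, σ l * topDualNorm N (l + 1) y := hsy ▸ scalarProduct_le_sum hN hz y
  have h2 : ∑ l, σ l ≤ 1 := hz.1
  have hterm : ∀ l ∈ Finset.univ, σ l * topDualNorm N (l + 1) y ≤ σ l := fun l _ =>
    mul_le_of_le_one_right (hσ0 l) ((topDualNorm_le_dualNorm hdual _ y).trans hy)
  have hsum := Finset.sum_le_sum hterm
  -- The chain `1 ≤ ∑ σ l * ‖y‖_l^top ≤ ∑ σ l ≤ 1` collapses, hence equality term by term and total
  -- mass one.
  have heq := (Finset.sum_eq_sum_iff_of_le hterm).1 (hsum.antisymm (h2.trans h1))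
  have hone : ∑ l, σ l = 1 := h2.antisymm (h1.trans hsum)
  -- Below level `ℓ₀(s)` the top norm of `y` is less than one, so termwise equality forces the mass
  -- to vanish.
  have hvanish : ∀ l : Fin d, l.succ < lzero s → σ l = 0 := fun l hls => by
    have hlt := (topDualNorm_lt_of_lt_lzero hdual (N := N) (y := y) (k := l + 1)
      (by rw [hl]; exact hls)).trans_le hy
    by_contra h
    have := heq l (Finset.mem_univ l)
    have hpos := (hσ0 l).lt_of_ne' h
    nlinarith
  calc φ (lzero s) = ∑ l, φ (lzero s) * σ l := by rw [← Finset.mul_sum, hone, mul_one]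
    _ ≤ decompositionCost N φ z := Finset.sum_le_sum fun l _ => by
      rcases lt_or_ge l.succ (lzero s) with h | h
      · rw [hvanish l h, mul_zero]
        exact mul_nonneg (hφ_nonneg _) (hσ0 l)
      · exact mul_le_mul_of_nonneg_right (hφ h) (hσ0 l)

theorem phiLzero_eq_calL (hN : IsNorm N) (hmono : OrthantStrictlyMonotonic N)
    (hdual : OrthantStrictlyMonotonic (dualNorm N)) (hφ : Monotone φ)
    (hφ_nonneg : ∀ k, 0 ≤ φ k) (hφ_zero : φ 0 = 0) {s : Fin d → ℝ} (hs : N s = 1) :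
    phiLzero φ s = calL N φ s := by
  refine le_antisymm ?_ (calL_le_of_mem_supportBall hN hmono hφ
    (mem_supportBall_of_lzero_le hN hs.le le_rfl))
  rw [(isMinOver_decompositions hN hmono hφ hφ_nonneg hφ_zero s).1]
  exact le_iInf₂ fun z hz => EReal.coe_le_coe_iff.2
    (le_decompositionCost_of_sphere hN hmono hdual hφ hφ_nonneg hs hz)

/-! ### Factorization through the normalization, and subdifferentials -/

theorem lzero_smul {a : ℝ} (ha : a ≠ 0) (x : Fin d → ℝ) : lzero (a • x) = lzero x := by
  simp [lzero, ha]

theorem phiLzero_eq_calL_inv_smul (hN : IsNorm N) (hmono : OrthantStrictlyMonotonic N)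
    (hdual : OrthantStrictlyMonotonic (dualNorm N)) (hφ : Monotone φ)
    (hφ_nonneg : ∀ k, 0 ≤ φ k) (hφ_zero : φ 0 = 0) {x : Fin d → ℝ} (hx : x ≠ 0) :
    phiLzero φ x = calL N φ ((N x)⁻¹ • x) := by
  have hpos := hN.pos hx
  rw [← phiLzero_eq_calL hN hmono hdual hφ hφ_nonneg hφ_zero
    (by rw [hN.smul_of_nonneg (by positivity), inv_mul_cancel₀ hpos.ne']), phiLzero, phiLzero,
    lzero_smul (inv_ne_zero hpos.ne')]

theorem phiLzero_eq_calL_comp_normalization (hN : IsNorm N) (hmono : OrthantStrictlyMonotonic N)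
    (hdual : OrthantStrictlyMonotonic (dualNorm N)) (hφ : Monotone φ)
    (hφ_nonneg : ∀ k, 0 ≤ φ k) (hφ_zero : φ 0 = 0) :
    phiLzero φ = calL N φ ∘ normalization N := by
  funext x
  by_cases hx : x = 0
  · simp [hx, normalization, calL_zero hN hmono hφ hφ_nonneg hφ_zero, phiLzero, lzero_zero,
      hφ_zero]
  · simpa [normalization, hx] using
      phiLzero_eq_calL_inv_smul hN hmono hdual hφ hφ_nonneg hφ_zero hx

/-- The Fenchel conjugate of `L` is the conjugate of `φ ∘ ℓ₀`. -/
theorem conjugate_scalarProduct_calL (hN : IsNorm N) (hmono : OrthantStrictlyMonotonic N)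
    (hdual : OrthantStrictlyMonotonic (dualNorm N)) (hφ : Monotone φ)
    (hφ_nonneg : ∀ k, 0 ≤ φ k) (hφ_zero : φ 0 = 0) :
    conjugate scalarProduct (calL N φ) = conjugate (coupling N) (phiLzero φ) := by
  funext y
  refine le_antisymm (iSup_le fun x => ?_) (iSup_le fun x => ?_)
  · rw [conjugate_coupling hN hmono hφ]
    have h : ((scalarProduct x y - envelope N φ y : ℝ) : EReal) ≤ calL N φ x := by
      rw [calL_eq hN hmono hφ]
      exact le_iSup (fun y => ((scalarProduct x y - envelope N φ y : ℝ) : EReal)) y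
    calc (scalarProduct x y : EReal) + -calL N φ x
        ≤ (scalarProduct x y : EReal) + -((scalarProduct x y - envelope N φ y : ℝ) : EReal) :=
          add_le_add_right (EReal.neg_le_neg_iff.2 h) _
      _ = (envelope N φ y : EReal) := by
          rw [← EReal.coe_neg, ← EReal.coe_add]
          congr 1
          ring
  -- Since `c(x, y) = ⟨n(x), y⟩` and `φ ∘ ℓ₀ = L ∘ n`, the Capra-conjugate is the Fenchel supremum
  -- restricted to the image of `n`.
  · rw [coupling_eq, congrFun
      (phiLzero_eq_calL_comp_normalization hN hmono hdual hφ hφ_nonneg hφ_zero) x]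
    exact le_iSup (fun x => (scalarProduct x y : EReal) + -calL N φ x) (normalization N x)

theorem subdifferential_eq (hN : IsNorm N) (hmono : OrthantStrictlyMonotonic N)
    (hdual : OrthantStrictlyMonotonic (dualNorm N)) (hφ : Monotone φ)
    (hφ_nonneg : ∀ k, 0 ≤ φ k) (hφ_zero : φ 0 = 0) {s : Fin d → ℝ} (hs : N s = 1) :
    subdifferential (coupling N) (phiLzero φ) s =
      subdifferential scalarProduct (calL N φ) s := by
  have hc : ∀ y, coupling N s y = scalarProduct s y := fun y => by
    have hs0 : s ≠ 0 := by
      rintro rfl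
      simp [hN.map_zero] at hs
    rw [coupling, if_neg hs0, hs, div_one]
  simp only [subdifferential, hc, conjugate_scalarProduct_calL hN hmono hdual hφ hφ_nonneg hφ_zero,
    phiLzero_eq_calL hN hmono hdual hφ hφ_nonneg hφ_zero hs]

end

end Capra

/-! ### The proposition -/

theorem mainTheorem2 (d : ℕ) (hd : 0 < d)
    -- a norm on `ℝ^d`: a seminorm that vanishes only at `0`
    (N : Seminorm ℝ (Fin d → ℝ)) (hN : ∀ x, N x = 0 → x = 0)
    (hmono : OrthantStrictlyMonotonic N) (hmono_dual : OrthantStrictlyMonotonic (dualNorm N))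
    (φ : Fin (d + 1) → ℝ) (hφ_nonneg : ∀ k, 0 ≤ φ k) (hφ_mono : Monotone φ) (hφ_zero : φ 0 = 0) :
    -- (a) proper convex lsc
    (IsProper (calL N φ) ∧ IsConvex (calL N φ) ∧ LowerSemicontinuous (calL N φ)) ∧
    -- (b) equality on the unit sphere
    (∀ s, N s = 1 → phiLzero φ s = calL N φ s) ∧
    -- (c) equality of the subdifferentials on the unit sphere
    (∀ s, N s = 1 → subdifferential (coupling N) (phiLzero φ) s =
      subdifferential scalarProduct (calL N φ) s) ∧
    -- (d) convex factorization
    (phiLzero φ = calL N φ ∘ normalization N ∧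
      ∀ x, x ≠ 0 → phiLzero φ x = calL N φ ((N x)⁻¹ • x)) ∧
    -- (e) expression as a conjugate
    (calL N φ = reverseFenchel
      (fun y => ⨆ l : Fin (d + 1), ((topDualNorm N l y - φ l : ℝ) : EReal))) ∧
    -- (f) largest convex lsc function below the step function on balls
    (IsLargestConvexLscBelow (calL N φ) (stepFunction (supportBall N) φ) ∧
      (∀ l : Fin d, ∀ x ∈ supportBall N (l + 1) \ supportBall N l,
        stepFunction (supportBall N) φ x = (φ l.succ : EReal)) ∧
      stepFunction (supportBall N) φ 0 = 0 ∧
      (∀ x, x ∉ supportBall N d → stepFunction (supportBall N) φ x = ⊤) ∧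
      (∀ l : Fin d, supportBall N l ⊆ supportBall N (l + 1)) ∧
      supportBall N d = {x | N x ≤ 1}) ∧
    -- (g) largest convex lsc function below the step function on spheres
    (IsLargestConvexLscBelow (calL N φ) (stepFunction (supportSphere N) φ) ∧
      ∀ x, stepFunction (supportSphere N) φ x =
        sInf ((fun l : Fin (d + 1) => (φ l : EReal)) '' {l | x ∈ supportSphere N l})) ∧
    -- (h) three variational expressions
    (∀ x,
      IsMinOver (simplexFeasible (supportBall N) x)
        (fun w => ∑ l : Fin d, w l.succ * φ l.succ) (calL N φ x) ∧
      IsMinOver (simplexFeasible (supportSphere N) x)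
        (fun w => ∑ l : Fin d, w l.succ * φ l.succ) (calL N φ x) ∧
      IsMinOver (decompositions N x)
        (fun z => ∑ l : Fin d, φ l.succ * supportDualNorm N (l + 1) (z l)) (calL N φ x)) := by
  have hN' : IsNorm N := isNorm_seminorm N hN
  refine ⟨⟨isProper_calL hN' hmono hφ_mono hφ_nonneg hφ_zero, isConvex_calL hN' hmono hφ_mono,
      lowerSemicontinuous_calL hN' hmono hφ_mono⟩,
    fun s hs => phiLzero_eq_calL hN' hmono hmono_dual hφ_mono hφ_nonneg hφ_zero hs,
    fun s hs => subdifferential_eq hN' hmono hmono_dual hφ_mono hφ_nonneg hφ_zero hs,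
    ⟨phiLzero_eq_calL_comp_normalization hN' hmono hmono_dual hφ_mono hφ_nonneg hφ_zero,
      fun x hx => phiLzero_eq_calL_inv_smul hN' hmono hmono_dual hφ_mono hφ_nonneg hφ_zero hx⟩,
    ?_,
    ⟨isLargestConvexLscBelow_supportBall hd hN' hmono hφ_mono hφ_nonneg hφ_zero,
      fun l x hx => stepFunction_supportBall_eq hN' hφ_mono hx,
      stepFunction_supportBall_zero N hφ_nonneg hφ_zero,
      fun x hx => stepFunction_supportBall_eq_top hN' hx,
      fun l => supportBall_subset_succ hN' l,
      supportBall_self hd hN' hmono_dual⟩,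
    ⟨isLargestConvexLscBelow_supportSphere hd hN' hmono hφ_mono hφ_nonneg hφ_zero,
      stepFunction_eq_sInf _ φ⟩,
    fun x => ⟨isMinOver_supportBall hd hN' hmono hφ_mono hφ_nonneg hφ_zero x,
      isMinOver_supportSphere hd hN' hmono hφ_mono hφ_nonneg hφ_zero x,
      isMinOver_decompositions hN' hmono hφ_mono hφ_nonneg hφ_zero x⟩⟩
  simp only [calL_eq_reverseFenchel hN' hmono hφ_mono, coe_envelope]
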